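/- Let $G=(V,E)$ be a finite simple triangle-free graph with $n$ vertices, $m$ edges and average degree $d=\frac1n\sum_{v\in V}d(v)\ge 2$, and let $a(G)$ denote the maximum size of a set of vertices $S\subseteq V$ such that the induced subgraph $G[S]$ is a forest. Then $$a(G)\ \ge\ \frac{3n}{d+2}.$$ Moreover, this lower bound is strictly larger than the Alon–Mubayi–Thomas lower bound when $d>4$, that is, $\frac{3n}{d+2}>n-\frac m4$ whenever $d>4$; and it is strictly larger than the Shi–Xu lower bound (known for connected triangle-free graphs) when $d\ge\frac92$, that is, $\frac{3n}{d+2}>\frac{20n-5m-5}{19}$ whenever $d\ge\frac92$. -/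

import Mathlib

/-- A set of vertices of a graph is acyclic if it induces a forest. -/
def SimpleGraph.IsAcyclicSet {V : Type*} (G : SimpleGraph V) (S : Set V) : Prop :=
  (G.induce S).IsAcyclic

open Classical in
/-- `a(G)`: the maximum size of an acyclic set of vertices of the finite graph `G`
(the empty set is acyclic, so the maximum is over a nonempty family). -/
noncomputable def SimpleGraph.acyclicSetNumber {V : Type*} [Fintype V] (G : SimpleGraph V) : ℕ :=
  (Finset.univ.filter fun S : Finset V => G.IsAcyclicSet (S : Set V)).sup Finset.card

/-- The average degree of a finite graph (zero for the graph without vertices). -/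
noncomputable def SimpleGraph.averageDegree {V : Type*} [Fintype V] (G : SimpleGraph V)
    [DecidableRel G.Adj] : ℝ :=
  (∑ v, (G.degree v : ℝ)) / (Fintype.card V : ℝ)

/-! Since `x ↦ 3 / (x + 2)` is convex, it lies below its chords over `[2, 4]` and over `[D - 1, D]`
for integers `D > 4`. On each interval it is enough to prove the chord bound, which is linear in `n`
and `m`. Linear bounds can be proved by induction over vertex subsets: keep a forest `T` joined to
the remainder by at most one edge, discard `R`, and check that enough edges disappear
(`exists_isSparse_of_reduction`).

The chord over `[2, 4]` is `n - m / 4`, where each discarded vertex must pay for four edges. Low and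
high degrees are immediate; cubic graphs need a suitably grown tree (`exists_cubic_reduction`).

The later chords follow by induction on `D` (`exists_isSparse_chord_succ`). After local reductions
the maximum degree is at most `D`, and the vertices of degree `D` span a graph of maximum degree at
most `D - 2`. That graph has a large independent set (`exists_independent`); deleting it lowers the
density enough for the previous chord to give the new one. -/

set_option linter.unusedSectionVars false

/-! ### Edge counts, sparse sets and the reduction principle -/

namespace SimpleGraph

variable {V : Type*} [DecidableEq V] (G : SimpleGraph V) [DecidableRel G.Adj]

/-- The number of adjacent ordered pairs in `A ×ˢ B`. -/
def adjCount (A B : Finset V) : ℤ :=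
  ∑ a ∈ A, ∑ b ∈ B, if G.Adj a b then 1 else 0

/-- Every nonempty subset `A` of `F` spans at most `#A - 1` edges. -/
def IsSparse (F : Finset V) : Prop :=
  ∀ A ⊆ F, A.Nonempty → G.adjCount A A + 2 ≤ 2 * (A.card : ℤ)

variable {G}

theorem adjCount_comm (A B : Finset V) : G.adjCount A B = G.adjCount B A := by
  unfold adjCount
  rw [Finset.sum_comm]
  simp only [G.adj_comm]

theorem adjCount_nonneg (A B : Finset V) : 0 ≤ G.adjCount A B :=
  Finset.sum_nonneg fun _ _ => Finset.sum_nonneg fun _ _ => by split <;> simp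

theorem adjCount_union_left {A B : Finset V} (h : Disjoint A B) (C : Finset V) :
    G.adjCount (A ∪ B) C = G.adjCount A C + G.adjCount B C :=
  Finset.sum_union h

theorem adjCount_union_right (C : Finset V) {A B : Finset V} (h : Disjoint A B) :
    G.adjCount C (A ∪ B) = G.adjCount C A + G.adjCount C B := by
  rw [adjCount_comm, adjCount_union_left h, adjCount_comm A, adjCount_comm B]

theorem adjCount_sdiff_right (C : Finset V) {A S : Finset V} (h : A ⊆ S) :
    G.adjCount C (S \ A) = G.adjCount C S - G.adjCount C A := by
  have := adjCount_union_right (G := G) C (Finset.sdiff_disjoint (s := A) (t := S))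
  rw [Finset.sdiff_union_of_subset h] at this
  linarith

theorem adjCount_sdiff_self {W S : Finset V} (h : W ⊆ S) :
    G.adjCount S S
      = G.adjCount (S \ W) (S \ W) + 2 * G.adjCount W S - G.adjCount W W := by
  rw [adjCount_sdiff_right _ h, adjCount_comm (S \ W) S, adjCount_comm (S \ W) W,
    adjCount_sdiff_right _ h, adjCount_sdiff_right _ h, adjCount_comm S W]
  ring

theorem adjCount_mono_right (C : Finset V) {A B : Finset V} (h : A ⊆ B) :
    G.adjCount C A ≤ G.adjCount C B :=
  Finset.sum_le_sum fun _ _ =>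
    Finset.sum_le_sum_of_subset_of_nonneg h fun _ _ _ => by split <;> simp

theorem adjCount_mono {A B C D : Finset V} (h : A ⊆ B) (h' : C ⊆ D) :
    G.adjCount A C ≤ G.adjCount B D :=
  (adjCount_mono_right A h').trans <| by
    rw [adjCount_comm A, adjCount_comm B]; exact adjCount_mono_right D h

theorem adjCount_eq_sum (A B : Finset V) :
    G.adjCount A B = ∑ a ∈ A, G.adjCount {a} B := by
  simp [adjCount]

theorem adjCount_singleton (v : V) (B : Finset V) :
    G.adjCount {v} B = ((B.filter (G.Adj v)).card : ℤ) := by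
  simp [adjCount]

theorem adjCount_singleton_self (v : V) : G.adjCount {v} {v} = 0 := by
  simp [adjCount]

theorem adjCount_singleton_of_adj {v w : V} (h : G.Adj v w) : G.adjCount {v} {w} = 1 := by
  simp [adjCount, Finset.filter_singleton, h]

theorem adjCount_singleton_of_not_adj {v w : V} (h : ¬ G.Adj v w) : G.adjCount {v} {w} = 0 := by
  simp [adjCount, h]

theorem adjCount_pos_iff {A B : Finset V} :
    1 ≤ G.adjCount A B ↔ ∃ a ∈ A, ∃ b ∈ B, G.Adj a b := by
  constructor
  · intro h
    by_contra! hc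
    have : G.adjCount A B = 0 :=
      Finset.sum_eq_zero fun a ha => Finset.sum_eq_zero fun b hb => by simp [hc a ha b hb]
    omega
  · rintro ⟨a, ha, b, hb, hab⟩
    rw [← adjCount_singleton_of_adj hab]
    exact adjCount_mono (by simpa using ha) (by simpa using hb)

theorem adjCount_eq_zero_iff {A B : Finset V} :
    G.adjCount A B = 0 ↔ ∀ a ∈ A, ∀ b ∈ B, ¬ G.Adj a b := by
  have h := adjCount_pos_iff (G := G) (A := A) (B := B)
  have h0 := adjCount_nonneg (G := G) A B
  constructor
  · intro h1 a ha b hb hab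
    have := h.2 ⟨a, ha, b, hb, hab⟩
    omega
  · intro h1
    by_contra h2
    obtain ⟨a, ha, b, hb, hab⟩ := h.1 (by omega)
    exact h1 a ha b hb hab

theorem adjCount_union_self {A B : Finset V} (h : Disjoint A B) :
    G.adjCount (A ∪ B) (A ∪ B)
      = G.adjCount A A + G.adjCount B B + 2 * G.adjCount A B := by
  rw [adjCount_union_left h, adjCount_union_right _ h, adjCount_union_right _ h,
    adjCount_comm B A]
  ring

theorem adjCount_self_even (A : Finset V) : Even (G.adjCount A A) := by
  induction A using Finset.induction_on with
  | empty => simp [adjCount]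
  | insert a A ha ih =>
    rw [Finset.insert_eq, adjCount_union_self (by simpa using ha), adjCount_singleton_self]
    obtain ⟨c, hc⟩ := ih
    exact ⟨c + G.adjCount {a} A, by rw [hc]; ring⟩

theorem isSparse_empty : G.IsSparse ∅ := by
  intro A hA hne
  simp [Finset.subset_empty.1 hA] at hne

theorem isSparse_singleton (v : V) : G.IsSparse {v} := by
  intro A hA hne
  rcases Finset.subset_singleton_iff.1 hA with rfl | rfl
  · simp at hne
  · simp [adjCount_singleton_self]

/-- One edge between two forests closes no cycle: a subset meeting both sides gains at most one
edge, and each side has one to spare. -/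
theorem IsSparse.union {T F : Finset V} (hT : G.IsSparse T) (hF : G.IsSparse F)
    (hd : Disjoint T F) (h : G.adjCount T F ≤ 1) : G.IsSparse (T ∪ F) := by
  intro A hA hne
  have hA' : A = (A ∩ T) ∪ (A ∩ F) := by
    rw [← Finset.inter_union_distrib_left, Finset.inter_eq_left.2 hA]
  have hd' : Disjoint (A ∩ T) (A ∩ F) :=
    hd.mono Finset.inter_subset_right Finset.inter_subset_right
  have he := adjCount_union_self (G := G) hd'
  have hc := Finset.card_union_of_disjoint hd'
  rw [← hA'] at he hc
  have hle : G.adjCount (A ∩ T) (A ∩ F) ≤ 1 :=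
    (adjCount_mono Finset.inter_subset_right Finset.inter_subset_right).trans h
  rcases (A ∩ T).eq_empty_or_nonempty with h1 | h1
  · rw [h1, Finset.empty_union] at hA'
    exact hF A (by rw [hA']; exact Finset.inter_subset_right) hne
  rcases (A ∩ F).eq_empty_or_nonempty with h2 | h2
  · rw [h2, Finset.union_empty] at hA'
    exact hT A (by rw [hA']; exact Finset.inter_subset_right) hne
  have e1 := hT _ Finset.inter_subset_right h1
  have e2 := hF _ Finset.inter_subset_right h2
  rw [he, hc]
  push_cast
  linarith

/-- Every vertex of a cycle has two neighbours on it, so the support of a cycle spans at least as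
many edges as vertices. -/
theorem IsSparse.isAcyclicSet {F : Finset V} (hF : G.IsSparse F) :
    G.IsAcyclicSet (F : Set V) := by
  intro v c hc
  let A : Finset V := c.support.toFinset.map (Function.Embedding.subtype _)
  have hA : A ⊆ F := by
    intro x hx
    simp only [A, Finset.mem_map, Function.Embedding.subtype_apply] at hx
    obtain ⟨y, -, rfl⟩ := hx
    exact y.2
  have hne : A.Nonempty := ⟨v, by simp [A]⟩
  have h2 : ∀ a ∈ A, 2 ≤ G.adjCount {a} A := by
    intro a ha
    simp only [A, Finset.mem_map, Function.Embedding.subtype_apply] at ha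
    obtain ⟨y, hy, rfl⟩ := ha
    have hy' : y ∈ c.support := by simpa using hy
    have hn := hc.ncard_neighborSet_toSubgraph_eq_two hy'
    obtain ⟨p, q, hpq, hs⟩ := Set.ncard_eq_two.1 hn
    have hp : c.toSubgraph.Adj y p := by
      have : p ∈ c.toSubgraph.neighborSet y := by rw [hs]; simp
      exact this
    have hq : c.toSubgraph.Adj y q := by
      have : q ∈ c.toSubgraph.neighborSet y := by rw [hs]; simp
      exact this
    have memA : ∀ z, c.toSubgraph.Adj y z → (z : V) ∈ A := by
      intro z hz
      have := hz.snd_mem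
      rw [Walk.mem_verts_toSubgraph] at this
      simp only [A, Finset.mem_map, Function.Embedding.subtype_apply]
      exact ⟨z, by simpa using this, rfl⟩
    rw [adjCount_singleton]
    have hsub : ({(p : V), (q : V)} : Finset V) ⊆ A.filter (G.Adj y) := by
      intro z hz
      simp only [Finset.mem_insert, Finset.mem_singleton] at hz
      rcases hz with rfl | rfl
      · exact Finset.mem_filter.2 ⟨memA _ hp, hp.adj_sub⟩
      · exact Finset.mem_filter.2 ⟨memA _ hq, hq.adj_sub⟩
    have hcard := Finset.card_le_card hsub
    rw [Finset.card_pair (fun h => hpq (Subtype.ext h))] at hcard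
    exact_mod_cast hcard
  have h3 := hF A hA hne
  have h4 : ∑ _a ∈ A, (2 : ℤ) ≤ ∑ a ∈ A, G.adjCount {a} A := Finset.sum_le_sum h2
  rw [← adjCount_eq_sum, Finset.sum_const, nsmul_eq_mul] at h4
  linarith

theorem CliqueFree.not_adj_of_adj_of_adj (h : G.CliqueFree 3) {a b c : V} (hab : G.Adj a b)
    (hac : G.Adj a c) : ¬ G.Adj b c := fun hbc =>
  h {a, b, c} (is3Clique_triple_iff.2 ⟨hab, hac, hbc⟩)

/-- Vertices of `T` are put into the forest and those of `R` are discarded, at a cost that the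
linear bound `g * #F ≥ α * #S - β * adjCount S S` tolerates. -/
theorem exists_isSparse_of_reduction (g α β : ℤ)
    (h : ∀ S : Finset V, S.Nonempty →
      (∃ F ⊆ S, G.IsSparse F ∧ α * S.card - β * G.adjCount S S ≤ g * F.card) ∨
      ∃ T R : Finset V, T ⊆ S ∧ R ⊆ S ∧ Disjoint T R ∧ (T ∪ R).Nonempty ∧ G.IsSparse T ∧
        G.adjCount T (S \ (T ∪ R)) ≤ 1 ∧
        0 ≤ g * T.card - α * (T.card + R.card)
          + β * (2 * G.adjCount (T ∪ R) S - G.adjCount (T ∪ R) (T ∪ R))) :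
    ∀ S : Finset V, ∃ F ⊆ S, G.IsSparse F ∧ α * S.card - β * G.adjCount S S ≤ g * F.card := by
  intro S
  induction S using Finset.strongInduction with
  | H S ih =>
    rcases S.eq_empty_or_nonempty with rfl | hS
    · exact ⟨∅, le_rfl, isSparse_empty, by simp [adjCount]⟩
    rcases h S hS with h1 | ⟨T, R, hT, hR, hd, hne, hsp, hcut, hval⟩
    · exact h1
    have hW : T ∪ R ⊆ S := Finset.union_subset hT hR
    obtain ⟨F, hFS, hF, hFv⟩ := ih (S \ (T ∪ R)) (Finset.sdiff_ssubset hW hne)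
    have hdis : Disjoint T F := by
      refine Finset.disjoint_of_subset_right hFS ?_
      exact Finset.disjoint_sdiff.mono_left Finset.subset_union_left
    refine ⟨T ∪ F, Finset.union_subset hT (hFS.trans Finset.sdiff_subset),
      hsp.union hF hdis ((adjCount_mono_right T hFS).trans hcut), ?_⟩
    have hc := Finset.card_sdiff_add_card_eq_card hW
    rw [Finset.card_union_of_disjoint hd] at hc
    have hc' : (S.card : ℤ) = (S \ (T ∪ R)).card + (T.card + R.card) := by
      exact_mod_cast hc.symm
    rw [Finset.card_union_of_disjoint hdis, adjCount_sdiff_self hW, hc']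
    push_cast
    linarith

end SimpleGraph

/-! ### Tree growth in cubic graphs and the bound `n - m / 4` -/

namespace SimpleGraph

variable {V : Type*} [DecidableEq V] (G : SimpleGraph V) [DecidableRel G.Adj]

/-- The vertices of `S \ T` with exactly one neighbour in `T`. -/
def onceAttached (S T : Finset V) : Finset V :=
  (S \ T).filter fun w => G.adjCount {w} T = 1

/-- The vertices of `S \ T` with at least two neighbours in `T`. -/
def multiplyAttached (S T : Finset V) : Finset V :=
  (S \ T).filter fun w => 2 ≤ G.adjCount {w} T

/-- `T` is nonempty and induces a tree. -/
structure IsTreeSet (T : Finset V) : Prop where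
  nonempty : T.Nonempty
  isSparse : G.IsSparse T
  adjCount_self : G.adjCount T T = 2 * T.card - 2

variable {G}

theorem mem_onceAttached {S T : Finset V} {w : V} :
    w ∈ G.onceAttached S T ↔ (w ∈ S ∧ w ∉ T) ∧ G.adjCount {w} T = 1 := by
  simp [onceAttached]

theorem mem_multiplyAttached {S T : Finset V} {w : V} :
    w ∈ G.multiplyAttached S T ↔ (w ∈ S ∧ w ∉ T) ∧ 2 ≤ G.adjCount {w} T := by
  simp [multiplyAttached]

theorem IsTreeSet.insert {S T : Finset V} (hT : G.IsTreeSet T) {u : V}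
    (hu : u ∈ G.onceAttached S T) : G.IsTreeSet (insert u T) := by
  obtain ⟨⟨-, huT⟩, hc⟩ := mem_onceAttached.1 hu
  have hd : Disjoint {u} T := by simpa using huT
  refine ⟨by simp, ?_, ?_⟩
  · rw [Finset.insert_eq]
    exact (isSparse_singleton u).union hT.isSparse hd hc.le
  · rw [Finset.card_insert_of_notMem huT, Finset.insert_eq, adjCount_union_self hd,
      adjCount_singleton_self, hT.adjCount_self, hc]
    push_cast
    ring

theorem isTreeSet_singleton (v : V) : G.IsTreeSet {v} :=
  ⟨by simp, isSparse_singleton v, by simp [adjCount_singleton_self]⟩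

theorem adjCount_insert_right (w : V) {u : V} {T : Finset V} (hu : u ∉ T) :
    G.adjCount {w} (insert u T) = G.adjCount {w} {u} + G.adjCount {w} T := by
  rw [Finset.insert_eq, adjCount_union_right _ (by simpa using hu)]

theorem onceAttached_insert {S T : Finset V} {u w : V} (hu : u ∈ G.onceAttached S T)
    (hw : w ∈ G.onceAttached S T) (hne : w ≠ u) (hadj : ¬ G.Adj w u) :
    w ∈ G.onceAttached S (insert u T) := by
  rw [mem_onceAttached] at *
  refine ⟨⟨hw.1.1, by simp [hne, hw.1.2]⟩, ?_⟩
  rw [adjCount_insert_right w hu.1.2, adjCount_singleton_of_not_adj hadj, hw.2, zero_add]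

/-- Among three vertices of a triangle-free graph two are non-adjacent; absorbing one of them leaves
the other attached once. -/
theorem exists_onceAttached_insert_nonempty (htri : G.CliqueFree 3) {S T : Finset V}
    (h : 3 ≤ (G.onceAttached S T).card) :
    ∃ u ∈ G.onceAttached S T, (G.onceAttached S (insert u T)).Nonempty := by
  obtain ⟨K, hK, hK3⟩ := Finset.exists_subset_card_eq h
  obtain ⟨a, b, c, hab, hac, hbc, rfl⟩ := Finset.card_eq_three.1 hK3
  have ha := hK (show a ∈ ({a, b, c} : Finset V) by simp)
  have hb := hK (show b ∈ ({a, b, c} : Finset V) by simp)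
  have hc := hK (show c ∈ ({a, b, c} : Finset V) by simp)
  by_cases h1 : G.Adj a b
  · by_cases h2 : G.Adj a c
    · have h3 := htri.not_adj_of_adj_of_adj h1 h2
      exact ⟨c, hc, b, onceAttached_insert hc hb hbc h3⟩
    · exact ⟨c, hc, a, onceAttached_insert hc ha hac h2⟩
  · exact ⟨b, hb, a, onceAttached_insert hb ha hab h1⟩

/-- Take a largest tree with at least three once-attached vertices and enlarge it by one of them,
keeping some vertex attached once; maximality forces the count to drop to at most two. -/
theorem exists_isTreeSet_onceAttached (htri : G.CliqueFree 3) {S : Finset V} (hS : S.Nonempty)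
    (h3 : ∀ v ∈ S, G.adjCount {v} S = 3) :
    ∃ T ⊆ S, G.IsTreeSet T ∧ 1 ≤ (G.onceAttached S T).card ∧
      (G.onceAttached S T).card ≤ 2 := by
  classical
  let P := S.powerset.filter fun T => G.IsTreeSet T ∧ 3 ≤ (G.onceAttached S T).card
  have hP : P.Nonempty := by
    obtain ⟨v, hv⟩ := hS
    refine ⟨{v}, Finset.mem_filter.2 ⟨by simpa using hv, isTreeSet_singleton v, ?_⟩⟩
    have h := h3 v hv
    rw [adjCount_singleton] at h
    have hsub : S.filter (G.Adj v) ⊆ G.onceAttached S {v} := by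
      intro w hw
      obtain ⟨hwS, hvw⟩ := Finset.mem_filter.1 hw
      exact mem_onceAttached.2 ⟨⟨hwS, by simpa using hvw.ne'⟩, adjCount_singleton_of_adj hvw.symm⟩
    have := Finset.card_le_card hsub
    omega
  obtain ⟨T, hTP, hmax⟩ := Finset.exists_max_image P Finset.card hP
  obtain ⟨hTS, hT, hk⟩ := Finset.mem_filter.1 hTP
  rw [Finset.mem_powerset] at hTS
  obtain ⟨u, hu, hne⟩ := exists_onceAttached_insert_nonempty htri hk
  have hu' := (mem_onceAttached.1 hu).1
  have hsub : insert u T ⊆ S := Finset.insert_subset hu'.1 hTS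
  refine ⟨insert u T, hsub, hT.insert hu, hne.card_pos, ?_⟩
  by_contra hc
  have := hmax (insert u T) (Finset.mem_filter.2
    ⟨Finset.mem_powerset.2 hsub, hT.insert hu, by omega⟩)
  rw [Finset.card_insert_of_notMem hu'.2] at this
  omega

theorem adjCount_sdiff_eq_card_add (S T : Finset V) :
    G.adjCount (S \ T) T
      = (G.onceAttached S T).card + G.adjCount (G.multiplyAttached S T) T := by
  rw [adjCount_eq_sum, adjCount_eq_sum (G.multiplyAttached S T), onceAttached, multiplyAttached,
    Finset.card_filter, Finset.sum_filter]
  push_cast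
  rw [← Finset.sum_add_distrib]
  refine Finset.sum_congr rfl fun w _ => ?_
  have := adjCount_nonneg (G := G) {w} T
  split_ifs <;> omega

theorem two_mul_card_multiplyAttached_le (S T : Finset V) :
    2 * ((G.multiplyAttached S T).card : ℤ) ≤ G.adjCount (G.multiplyAttached S T) T := by
  rw [adjCount_eq_sum (G.multiplyAttached S T)]
  have : ∑ _w ∈ G.multiplyAttached S T, (2 : ℤ)
      ≤ ∑ w ∈ G.multiplyAttached S T, G.adjCount {w} T :=
    Finset.sum_le_sum fun w hw => (mem_multiplyAttached.1 hw).2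
  rw [Finset.sum_const, nsmul_eq_mul] at this
  linarith

theorem adjCount_of_regular {S A : Finset V} {d : ℤ} (hA : A ⊆ S)
    (h : ∀ v ∈ S, G.adjCount {v} S = d) : G.adjCount A S = d * A.card := by
  rw [adjCount_eq_sum, Finset.sum_congr rfl fun v hv => h v (hA hv), Finset.sum_const,
    nsmul_eq_mul, mul_comm]

/-- The edge counts when a tree `T` and a disjoint set `R` are removed from a cubic graph. -/
theorem IsTreeSet.adjCount_cubic {S T R : Finset V} (hT : G.IsTreeSet T) (hTS : T ⊆ S)
    (hRS : R ⊆ S) (hd : Disjoint T R) (h3 : ∀ v ∈ S, G.adjCount {v} S = 3) :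
    G.adjCount T (S \ (T ∪ R)) = T.card + 2 - G.adjCount R T ∧
    2 * G.adjCount (T ∪ R) S - G.adjCount (T ∪ R) (T ∪ R)
      = 4 * T.card + 3 * R.card + 2 - G.adjCount R T + G.adjCount R (S \ (T ∪ R)) ∧
    G.adjCount R (S \ (T ∪ R)) = 3 * R.card - G.adjCount R T - G.adjCount R R := by
  have hW : T ∪ R ⊆ S := Finset.union_subset hTS hRS
  rw [adjCount_sdiff_right _ hW, adjCount_sdiff_right _ hW, adjCount_union_self hd,
    adjCount_union_left hd, adjCount_union_right _ hd, adjCount_union_right _ hd,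
    adjCount_of_regular hTS h3, adjCount_of_regular hRS h3, adjCount_comm T R, hT.adjCount_self]
  refine ⟨?_, ?_, ?_⟩ <;> ring

/-- A vertex with two neighbours in a tree of a triangle-free graph is not joined to all of it. -/
theorem IsTreeSet.adjCount_lt_card (htri : G.CliqueFree 3) {T : Finset V} (hT : G.IsTreeSet T)
    {w : V} (hw : 2 ≤ G.adjCount {w} T) : G.adjCount {w} T < T.card := by
  rw [adjCount_singleton] at *
  have hle := Finset.card_filter_le T (G.Adj w)
  by_contra hc
  have hall : ∀ x ∈ T, G.Adj w x := by
    have : (T.filter (G.Adj w)).card = T.card := by omega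
    exact Finset.card_filter_eq_iff.1 this
  have h1 := hT.adjCount_self
  obtain ⟨a, ha, b, hb, hab⟩ := adjCount_pos_iff.1 (show 1 ≤ G.adjCount T T by omega)
  exact htri.not_adj_of_adj_of_adj (hall a ha) (hall b hb) hab

/-- In a cubic triangle-free graph some tree, cut off up to one edge by deleting `R`, meets
together with `R` at least `4 * #R` edges. -/
theorem exists_cubic_reduction (htri : G.CliqueFree 3) {S : Finset V} (hS : S.Nonempty)
    (h3 : ∀ v ∈ S, G.adjCount {v} S = 3) :
    ∃ T R : Finset V, T ⊆ S ∧ R ⊆ S ∧ Disjoint T R ∧ (T ∪ R).Nonempty ∧ G.IsSparse T ∧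
      G.adjCount T (S \ (T ∪ R)) ≤ 1 ∧
      8 * (R.card : ℤ) ≤ 2 * G.adjCount (T ∪ R) S - G.adjCount (T ∪ R) (T ∪ R) := by
  obtain ⟨T, hTS, hT, hk1, hk2⟩ := exists_isTreeSet_onceAttached htri hS h3
  set M := G.multiplyAttached S T with hM
  have hMS : M ⊆ S := (Finset.filter_subset _ _).trans Finset.sdiff_subset
  have hTM : Disjoint T M :=
    Finset.disjoint_of_subset_right (Finset.filter_subset _ _) Finset.disjoint_sdiff
  have ht := hT.nonempty.card_pos
  have hsum : G.adjCount M T = T.card + 2 - (G.onceAttached S T).card := by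
    have e1 := adjCount_sdiff_eq_card_add (G := G) S T
    rw [adjCount_comm, adjCount_sdiff_right _ hTS, adjCount_of_regular hTS h3,
      hT.adjCount_self] at e1
    linarith
  have h2M := two_mul_card_multiplyAttached_le (G := G) S T
  rw [← hM] at h2M
  -- The tree sends `#T + 2` edges out, at most two of them to once-attached vertices, so a single
  -- vertex of `M` would be joined to all of `T`.
  have hM2 : 2 ≤ M.card := by
    by_contra hc
    rcases M.eq_empty_or_nonempty with h0 | h0
    · rw [h0] at hsum
      simp [adjCount] at hsum
      omega
    · obtain ⟨w, hw⟩ := Finset.card_eq_one.1 (show M.card = 1 by have := h0.card_pos; omega)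
      have hwM : w ∈ M := by simp [hw]
      have hw2 := hT.adjCount_lt_card htri (mem_multiplyAttached.1 hwM).2
      rw [hw] at hsum
      omega
  rcases (show (G.onceAttached S T).card = 1 ∨ (G.onceAttached S T).card = 2 by omega) with
    hk | hk
  · obtain ⟨c1, c2, -⟩ := hT.adjCount_cubic hTS hMS hTM h3
    have c4 := adjCount_nonneg (G := G) M (S \ (T ∪ M))
    refine ⟨T, M, hTS, hMS, hTM, hT.nonempty.mono Finset.subset_union_left, hT.isSparse, ?_, ?_⟩
    · rw [c1, hsum, hk]; norm_num
    -- With `r = #M`, `2r ≤ #T + 1` makes the count at least `9r - 2`, and `r ≥ 2`.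
    · rw [c2]; rw [hk] at hsum; push_cast at hsum; omega
  -- One of the two once-attached vertices must be discarded too, and an edge from `R` to the
  -- remainder is needed. If neither choice gave one, a neighbour `z` of `y` outside `T` would
  -- contradict the choice `x` when `z ∈ insert x M`, and the choice `y` otherwise.
  · have key : ∃ u ∈ G.onceAttached S T,
        1 ≤ G.adjCount (insert u M) (S \ (T ∪ insert u M)) := by
      obtain ⟨x, y, hxy, hK⟩ := Finset.card_eq_two.1 hk
      have hx : x ∈ G.onceAttached S T := by simp [hK]
      have hy : y ∈ G.onceAttached S T := by simp [hK]
      by_contra! hc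
      have hx0 := hc x hx
      have hy0 := hc y hy
      obtain ⟨⟨hxS, hxT⟩, hx1⟩ := mem_onceAttached.1 hx
      obtain ⟨⟨hyS, hyT⟩, hy1⟩ := mem_onceAttached.1 hy
      have hyM : y ∉ M := fun h => by have := (mem_multiplyAttached.1 h).2; omega
      have hxM : x ∉ M := fun h => by have := (mem_multiplyAttached.1 h).2; omega
      have hz0 : 1 ≤ G.adjCount {y} (S \ insert y T) := by
        rw [adjCount_sdiff_right _ (Finset.insert_subset hyS hTS), adjCount_insert_right y hyT,
          adjCount_singleton_self, h3 y hyS, hy1]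
        norm_num
      obtain ⟨y', hy', z, hz, hyz⟩ := adjCount_pos_iff.1 hz0
      obtain rfl := Finset.mem_singleton.1 hy'
      simp only [Finset.mem_sdiff, Finset.mem_insert, not_or] at hz
      by_cases hzM : z ∈ insert x M
      · refine absurd (adjCount_pos_iff.2 ⟨z, hzM, y', ?_, hyz.symm⟩) hx0.not_ge
        simp [hyS, hyT, hyM, hxy.symm]
      · refine absurd (adjCount_pos_iff.2 ⟨y', by simp, z, ?_, hyz⟩) hy0.not_ge
        simp only [Finset.mem_insert, not_or] at hzM
        simp [hz.1, hz.2.1, hz.2.2, hzM.2]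
    obtain ⟨u, hu, hu1⟩ := key
    obtain ⟨⟨huS, huT⟩, huc⟩ := mem_onceAttached.1 hu
    have huM : u ∉ M := fun h => by have := (mem_multiplyAttached.1 h).2; omega
    have hRS : insert u M ⊆ S := Finset.insert_subset huS hMS
    have hTR : Disjoint T (insert u M) := Finset.disjoint_insert_right.2 ⟨huT, hTM⟩
    have hRT : G.adjCount (insert u M) T = T.card + 1 := by
      rw [Finset.insert_eq, adjCount_union_left (by simpa using huM), huc, hsum, hk]
      push_cast
      ring
    have hcard : ((insert u M).card : ℤ) = M.card + 1 := by
      rw [Finset.card_insert_of_notMem huM]; push_cast; rfl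
    obtain ⟨c1, c2, c3⟩ := hT.adjCount_cubic hTS hRS hTR h3
    -- With `r = #R` and `c` edges from `R` to the remainder, the count is at least `9r - 5 + c`.
    -- This suffices unless `r = 3`, `#T = 4`, `c = 1`, which parity excludes because `c = 3r - (#T
    -- + 1) - adjCount R R`.
    obtain ⟨p, hp⟩ := adjCount_self_even (G := G) (insert u M)
    refine ⟨T, insert u M, hTS, hRS, hTR, hT.nonempty.mono Finset.subset_union_left,
      hT.isSparse, ?_, ?_⟩
    · rw [c1, hRT]; linarith
    · rw [c2]
      rw [hk] at hsum
      push_cast at hsum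
      omega

/-- The bound `a(G) ≥ n - m / 4` for triangle-free graphs. -/
theorem exists_isSparse_quarter (htri : G.CliqueFree 3) (S : Finset V) :
    ∃ F ⊆ S, G.IsSparse F ∧ 8 * (S.card : ℤ) - 1 * G.adjCount S S ≤ 8 * F.card := by
  refine exists_isSparse_of_reduction 8 8 1 (fun S hS => Or.inr ?_) S
  suffices h : ∃ T R : Finset V, T ⊆ S ∧ R ⊆ S ∧ Disjoint T R ∧ (T ∪ R).Nonempty ∧
      G.IsSparse T ∧ G.adjCount T (S \ (T ∪ R)) ≤ 1 ∧
      8 * (R.card : ℤ) ≤ 2 * G.adjCount (T ∪ R) S - G.adjCount (T ∪ R) (T ∪ R) by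
    obtain ⟨T, R, h1, h2, h3, h4, h5, h6, h7⟩ := h
    exact ⟨T, R, h1, h2, h3, h4, h5, h6, by linarith⟩
  by_cases hlow : ∃ v ∈ S, G.adjCount {v} S ≤ 1
  · obtain ⟨v, hv, hv1⟩ := hlow
    refine ⟨{v}, ∅, by simpa using hv, by simp, by simp, by simp, isSparse_singleton v,
      (adjCount_mono_right _ Finset.sdiff_subset).trans hv1, ?_⟩
    have := adjCount_nonneg (G := G) {v} S
    simp [adjCount_singleton_self, this]
  by_cases hhigh : ∃ v ∈ S, 4 ≤ G.adjCount {v} S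
  · obtain ⟨v, hv, hv4⟩ := hhigh
    refine ⟨∅, {v}, by simp, by simpa using hv, by simp, by simp, isSparse_empty,
      by simp [adjCount], ?_⟩
    simp [adjCount_singleton_self]
    linarith
  push Not at hlow hhigh
  by_cases htwo : ∃ v ∈ S, G.adjCount {v} S = 2
  · obtain ⟨v, hv, hv2⟩ := htwo
    have hcard := hv2
    rw [adjCount_singleton] at hcard
    obtain ⟨a, b, hab, hN⟩ := Finset.card_eq_two.1 (show (S.filter (G.Adj v)).card = 2 by omega)
    have haN : a ∈ S.filter (G.Adj v) := by simp [hN]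
    have hbN : b ∈ S.filter (G.Adj v) := by simp [hN]
    obtain ⟨haS, hva⟩ := Finset.mem_filter.1 haN
    obtain ⟨hbS, hvb⟩ := Finset.mem_filter.1 hbN
    have hnab := htri.not_adj_of_adj_of_adj hva hvb
    have ha2 := hlow a haS
    have hb2 := hlow b hbS
    have eva : G.adjCount {v} {a} = 1 := adjCount_singleton_of_adj hva
    have evb : G.adjCount {v} {b} = 1 := adjCount_singleton_of_adj hvb
    have eab : G.adjCount {a} {b} = 0 := adjCount_singleton_of_not_adj hnab
    have dva : Disjoint ({v} : Finset V) {a} := by simpa using hva.ne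
    -- Discarding `a` and keeping `v` destroys at least `2 + 3 - 1 = 4` edges. If `a` has degree 2
    -- instead, keeping `v` and `a` and discarding `b` destroys at least `2 + 2 + 2 - 2 = 4`.
    by_cases ha3 : 3 ≤ G.adjCount {a} S
    · have hsub : ({v} ∪ {a} : Finset V) ⊆ S := by
        intro x; simp only [Finset.mem_union, Finset.mem_singleton]; rintro (rfl | rfl) <;> assumption
      refine ⟨{v}, {a}, by simpa using hv, by simpa using haS, dva, by simp,
        isSparse_singleton v, ?_, ?_⟩
      · rw [adjCount_sdiff_right _ hsub, adjCount_union_right _ dva, adjCount_singleton_self]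
        omega
      · rw [adjCount_union_self dva, adjCount_union_left dva, adjCount_singleton_self,
          adjCount_singleton_self, Finset.card_singleton]
        push_cast
        omega
    · have dvab : Disjoint ({v} ∪ {a} : Finset V) {b} := by
        simp only [Finset.disjoint_singleton_right, Finset.mem_union, Finset.mem_singleton, not_or]
        exact ⟨hvb.ne', hab.symm⟩
      have hsub1 : ({v} ∪ {a} : Finset V) ⊆ S := by
        intro x; simp only [Finset.mem_union, Finset.mem_singleton]; rintro (rfl | rfl) <;> assumption
      have hbS' : ({b} : Finset V) ⊆ S := by simpa using hbS
      refine ⟨{v} ∪ {a}, {b}, hsub1, hbS', dvab, by simp,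
        (isSparse_singleton v).union (isSparse_singleton a) dva eva.le, ?_, ?_⟩
      · rw [adjCount_sdiff_right _ (Finset.union_subset hsub1 hbS'),
          adjCount_union_right _ dvab, adjCount_union_self dva, adjCount_union_left dva,
          adjCount_union_left dva, adjCount_singleton_self, adjCount_singleton_self]
        omega
      · rw [adjCount_union_self dvab, adjCount_union_left dvab, adjCount_union_self dva,
          adjCount_union_left dva, adjCount_union_left dva, adjCount_singleton_self,
          adjCount_singleton_self, adjCount_singleton_self, Finset.card_singleton]
        push_cast
        omega
  · push Not at htwo
    refine exists_cubic_reduction htri hS fun v hv => ?_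
    have := hlow v hv
    have := hhigh v hv
    have := htwo v hv
    omega

end SimpleGraph

/-! ### Independent sets and the chord bounds for `D ≥ 4` -/

namespace SimpleGraph

variable {V : Type*} [DecidableEq V] {G : SimpleGraph V} [DecidableRel G.Adj]

theorem CliqueFree.adjCount_eq_zero_of_forall_adj (htri : G.CliqueFree 3) {v : V} {R : Finset V}
    (h : ∀ w ∈ R, G.Adj v w) : G.adjCount R R = 0 :=
  adjCount_eq_zero_iff.2 fun a ha b hb => htri.not_adj_of_adj_of_adj (h a ha) (h b hb)

theorem adjCount_singleton_of_forall_adj {v : V} {R : Finset V} (h : ∀ w ∈ R, G.Adj v w) :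
    G.adjCount {v} R = R.card := by
  rw [adjCount_singleton, Finset.filter_true_of_mem h]

/-- A triangle-free graph with `n` vertices and maximum degree `k` has an independent set of
size at least `2 * n / (k + 4)`, in a linear form suited to induction. -/
theorem exists_independent (htri : G.CliqueFree 3) (k : ℤ) (H : Finset V) :
    ∃ X ⊆ H, G.adjCount X X = 0 ∧
      (4 * k + 8) * (H.card : ℤ) - 2 * G.adjCount H H ≤ (k + 4) ^ 2 * X.card := by
  induction H using Finset.strongInduction with
  | H H ih =>
    rcases H.eq_empty_or_nonempty with rfl | hH
    · exact ⟨∅, le_rfl, by simp [adjCount], by simp [adjCount]⟩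
    obtain ⟨v, hv, hmin⟩ := Finset.exists_min_image H (fun v => G.adjCount {v} H) hH
    set N := H.filter (G.Adj v) with hN
    have hNadj : ∀ w ∈ N, G.Adj v w := fun w hw => (Finset.mem_filter.1 hw).2
    have hvN : Disjoint {v} N := by simp [hN]
    have hW : {v} ∪ N ⊆ H :=
      Finset.union_subset (by simpa using hv) (Finset.filter_subset _ _)
    have hdeg : G.adjCount {v} H = N.card := adjCount_singleton v H
    obtain ⟨X, hXH, hX0, hX⟩ := ih (H \ ({v} ∪ N)) (Finset.sdiff_ssubset hW (by simp))
    have hvX : v ∉ X := fun h => by have := hXH h; simp at this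
    have hvX0 : G.adjCount {v} X = 0 := by
      refine adjCount_eq_zero_iff.2 fun a ha b hb hab => ?_
      obtain rfl := Finset.mem_singleton.1 ha
      have := hXH hb
      simp only [hN, Finset.mem_sdiff, Finset.mem_union, Finset.mem_filter] at this
      exact this.2 (Or.inr ⟨this.1, hab⟩)
    have hd : Disjoint {v} X := by simpa using hvX
    refine ⟨{v} ∪ X, Finset.union_subset (by simpa using hv) (hXH.trans Finset.sdiff_subset),
      ?_, ?_⟩
    · rw [adjCount_union_self hd, adjCount_singleton_self, hX0, hvX0]; rfl
    -- A vertex of minimum degree is chosen and its neighbourhood `N` is independent, so at least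
    -- `#N ^ 2` edges vanish with it.
    · have hNH : (N.card : ℤ) * N.card ≤ G.adjCount N H := by
        rw [adjCount_eq_sum, ← nsmul_eq_mul, ← Finset.sum_const]
        exact Finset.sum_le_sum fun w hw => hdeg ▸ hmin w (Finset.mem_filter.1 hw).1
      have hc : (H.card : ℤ) = (H \ ({v} ∪ N)).card + (1 + N.card) := by
        have := Finset.card_sdiff_add_card_eq_card hW
        rw [Finset.card_union_of_disjoint hvN, Finset.card_singleton] at this
        exact_mod_cast this.symm
      rw [adjCount_sdiff_self hW, adjCount_union_self hvN, adjCount_union_left hvN,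
        adjCount_singleton_self, htri.adjCount_eq_zero_of_forall_adj hNadj,
        adjCount_singleton_of_forall_adj hNadj, hdeg, hc, Finset.card_union_of_disjoint hd,
        Finset.card_singleton]
      push_cast
      nlinarith [sq_nonneg (2 * (N.card : ℤ) - (k + 2))]

/-- The hypothesis `ih` is the chord over `[D - 2, D - 1]`. It is applied after deleting an
independent set of vertices of degree `D`, once no local reduction remains. -/
theorem exists_isSparse_chord_succ (htri : G.CliqueFree 3) (D : ℕ) (hD : 5 ≤ D)
    (ih : ∀ S : Finset V, ∃ F ⊆ S, G.IsSparse F ∧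
      3 * (2 * (D : ℤ) - 1) * S.card - 3 * G.adjCount S S ≤ D * (D + 1) * F.card)
    (S : Finset V) :
    ∃ F ⊆ S, G.IsSparse F ∧
      3 * (2 * (D : ℤ) + 1) * S.card - 3 * G.adjCount S S ≤ (D + 1) * (D + 2) * F.card := by
  have hD' : (5 : ℤ) ≤ D := by exact_mod_cast hD
  refine exists_isSparse_of_reduction _ _ 3 (fun S hS => ?_) S
  by_cases hhigh : ∃ v ∈ S, (D : ℤ) + 1 ≤ G.adjCount {v} S
  · obtain ⟨v, hv, hvD⟩ := hhigh
    refine Or.inr ⟨∅, {v}, by simp, by simpa using hv, by simp, by simp, isSparse_empty,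
      by simp [adjCount], ?_⟩
    simp [adjCount_singleton_self]
    linarith
  push Not at hhigh
  set H := S.filter fun v => G.adjCount {v} S = D with hH
  have hHS : H ⊆ S := Finset.filter_subset _ _
  have hHdeg : ∀ A ⊆ H, G.adjCount A S = D * A.card := fun A hA => by
    rw [adjCount_eq_sum, Finset.sum_congr rfl fun v hv => (Finset.mem_filter.1 (hA hv)).2,
      Finset.sum_const, nsmul_eq_mul, mul_comm]
  by_cases hleaf : ∃ v ∈ H, (D : ℤ) - 1 ≤ G.adjCount {v} H
  · obtain ⟨v, hvH, hvD⟩ := hleaf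
    rw [adjCount_singleton] at hvD
    obtain ⟨R, hR, hRc⟩ := Finset.exists_subset_card_eq
      (show D - 1 ≤ (H.filter (G.Adj v)).card by omega)
    have hRH : R ⊆ H := hR.trans (Finset.filter_subset _ _)
    have hRadj : ∀ w ∈ R, G.Adj v w := fun w hw => (Finset.mem_filter.1 (hR hw)).2
    have hd : Disjoint {v} R := by
      simpa using fun h => (hRadj v h).ne rfl
    have hvS : {v} ⊆ S := by simpa using hHS hvH
    have hRc' : (R.card : ℤ) = D - 1 := by omega
    have hvdeg : G.adjCount {v} S = D := (Finset.mem_filter.1 hvH).2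
    refine Or.inr ⟨{v}, R, hvS, hRH.trans hHS, hd, by simp, isSparse_singleton v, ?_, ?_⟩
    · rw [adjCount_sdiff_right _ (Finset.union_subset hvS (hRH.trans hHS)),
        adjCount_union_right _ hd, adjCount_singleton_self,
        adjCount_singleton_of_forall_adj hRadj, hvdeg]
      omega
    · rw [adjCount_union_self hd, adjCount_union_left hd, adjCount_singleton_self,
        htri.adjCount_eq_zero_of_forall_adj hRadj, adjCount_singleton_of_forall_adj hRadj,
        hvdeg, hHdeg R hRH, hRc', Finset.card_singleton]
      push_cast
      -- The surplus is exactly `(D - 2) * (D - 4)`.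
      nlinarith
  · push Not at hleaf
    left
    obtain ⟨X, hXH, hX0, hX⟩ := exists_independent htri ((D : ℤ) - 2) H
    have hHH : G.adjCount H H ≤ (D - 2) * H.card := by
      rw [adjCount_eq_sum, mul_comm, ← nsmul_eq_mul, ← Finset.sum_const]
      exact Finset.sum_le_sum fun v hv => by have := hleaf v hv; omega
    -- Maximum degree `k = D - 2` in `H` turns the linear estimate into `2 * #H ≤ (k + 4) * #X`.
    have hXc : 2 * (H.card : ℤ) ≤ (D + 2) * X.card := by
      have h1 : (D + 2) * (2 * (H.card : ℤ)) ≤ (D + 2) * ((D + 2) * X.card) := by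
        nlinarith
      exact le_of_mul_le_mul_left h1 (by linarith)
    have hXS : X ⊆ S := hXH.trans hHS
    obtain ⟨F, hFS, hF, hFv⟩ := ih (S \ X)
    have hsum : G.adjCount S S ≤ (D - 1) * S.card + H.card := by
      rw [hH, Finset.card_filter, adjCount_eq_sum, mul_comm, ← nsmul_eq_mul, ← Finset.sum_const]
      push_cast
      rw [← Finset.sum_add_distrib]
      refine Finset.sum_le_sum fun v hv => ?_
      have := hhigh v hv
      split_ifs <;> omega
    have hc : (S.card : ℤ) = (S \ X).card + X.card := by
      exact_mod_cast (Finset.card_sdiff_add_card_eq_card hXS).symm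
    have he := adjCount_sdiff_self (G := G) hXS
    rw [hHdeg X hXH, hX0] at he
    refine ⟨F, hFS.trans Finset.sdiff_subset, hF, ?_⟩
    have h1 : 3 * (2 * (D : ℤ) - 1) * S.card - 3 * G.adjCount S S + 3 * X.card
        ≤ D * (D + 1) * F.card := by
      rw [hc, he]; linarith
    -- After scaling `h1` by `D + 2`, the difference of the left sides is `6(D - 1)#S - 6 adjCount S
    -- S + 3(D + 2)#X`, nonnegative by `hsum` and `hXc`.
    have h2 : (D : ℤ) * (3 * (2 * (D : ℤ) + 1) * S.card - 3 * G.adjCount S S)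
        ≤ D * ((D + 1) * (D + 2) * F.card) := by
      nlinarith [mul_le_mul_of_nonneg_left h1 (show (0 : ℤ) ≤ D + 2 by linarith)]
    exact le_of_mul_le_mul_left h2 (by linarith)

/-- Once the maximum degree is at most 4, so is the average degree, and there the bound `n - m / 4`
is the stronger one: both lines equal `n / 2` at average degree 4. -/
theorem exists_isSparse_chord_four (htri : G.CliqueFree 3) (S : Finset V) :
    ∃ F ⊆ S, G.IsSparse F ∧ 27 * (S.card : ℤ) - 3 * G.adjCount S S ≤ 30 * F.card := by
  refine exists_isSparse_of_reduction 30 27 3 (fun S hS => ?_) S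
  by_cases hhigh : ∃ v ∈ S, 5 ≤ G.adjCount {v} S
  · obtain ⟨v, hv, hvD⟩ := hhigh
    refine Or.inr ⟨∅, {v}, by simp, by simpa using hv, by simp, by simp, isSparse_empty,
      by simp [adjCount], ?_⟩
    simp [adjCount_singleton_self]
    linarith
  · push Not at hhigh
    obtain ⟨F, hFS, hF, h⟩ := exists_isSparse_quarter htri S
    have : G.adjCount S S ≤ S.card * 4 := by
      rw [adjCount_eq_sum, ← nsmul_eq_mul, ← Finset.sum_const]
      exact Finset.sum_le_sum fun v hv => by have := hhigh v hv; omega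
    exact Or.inl ⟨F, hFS, hF, by linarith⟩

/-- The bound on induced forests given by the chord of `x ↦ 3 / (x + 2)` over `[D - 1, D]`. -/
theorem exists_isSparse_chord (htri : G.CliqueFree 3) (D : ℕ) (hD : 4 ≤ D) (S : Finset V) :
    ∃ F ⊆ S, G.IsSparse F ∧
      3 * (2 * (D : ℤ) + 1) * S.card - 3 * G.adjCount S S ≤ (D + 1) * (D + 2) * F.card := by
  induction D, hD using Nat.le_induction generalizing S with
  | base =>
    obtain ⟨F, hFS, hF, h⟩ := exists_isSparse_chord_four htri S
    exact ⟨F, hFS, hF, by push_cast; linarith⟩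
  | succ D hD ih =>
    refine exists_isSparse_chord_succ htri (D + 1) (by omega) (fun S => ?_) S
    obtain ⟨F, hFS, hF, h⟩ := ih S
    exact ⟨F, hFS, hF, by push_cast; linarith⟩

/-! ### Passage to `a(G)` and the numerical comparisons -/

theorem IsSparse.card_le_acyclicSetNumber [Fintype V] {F : Finset V} (hF : G.IsSparse F) :
    F.card ≤ G.acyclicSetNumber := by
  classical
  exact Finset.le_sup (f := Finset.card) (by simpa using hF.isAcyclicSet)

theorem adjCount_univ [Fintype V] :
    G.adjCount Finset.univ Finset.univ = 2 * (G.edgeFinset.card : ℤ) := by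
  rw [adjCount_eq_sum]
  have := G.sum_degrees_eq_twice_card_edges
  have h : ∀ v, G.adjCount {v} Finset.univ = G.degree v := fun v => by
    rw [adjCount_singleton, ← card_neighborFinset_eq_degree, neighborFinset_eq_filter]
  simp only [h]
  exact_mod_cast this

end SimpleGraph

theorem corollary1p8 {V : Type*} [Fintype V] (G : SimpleGraph V) [DecidableRel G.Adj]
    (n m : ℕ) (hn : n = Fintype.card V) (hm : m = G.edgeFinset.card)
    (d : ℝ) (hd : d = G.averageDegree) (hd2 : 2 ≤ d) (htri : G.CliqueFree 3) :
    (G.acyclicSetNumber : ℝ) ≥ 3 * (n : ℝ) / (d + 2) ∧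
    (4 < d → 3 * (n : ℝ) / (d + 2) > (n : ℝ) - (m : ℝ) / 4) ∧
    (9 / 2 ≤ d → 3 * (n : ℝ) / (d + 2) > (20 * (n : ℝ) - 5 * (m : ℝ) - 5) / 19) := by
  classical
  have hnpos : (0 : ℝ) < n := by
    rcases Nat.eq_zero_or_pos n with h | h
    -- Without vertices the average degree is `0` by convention, against `2 ≤ d`.
    · rw [SimpleGraph.averageDegree, ← hn, h] at hd
      norm_num at hd
      linarith
    · exact_mod_cast h
  have hmd : 2 * (m : ℝ) = n * d := by
    have h1 : ∑ v, (G.degree v : ℝ) = 2 * (m : ℝ) := by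
      rw [hm]; exact_mod_cast G.sum_degrees_eq_twice_card_edges
    rw [hd, SimpleGraph.averageDegree, h1, ← hn]
    field_simp
  have hm' : (m : ℝ) = n * d / 2 := by linarith
  have hpos : 0 < d + 2 := by linarith
  have hcard : ((Finset.univ : Finset V).card : ℤ) = n := by simp [hn]
  have he : G.adjCount Finset.univ Finset.univ = 2 * (m : ℤ) := by
    rw [SimpleGraph.adjCount_univ, hm]
  refine ⟨?_, fun h4 => ?_, fun h9 => ?_⟩
  · rw [ge_iff_le, div_le_iff₀ hpos]
    rcases le_or_gt d 4 with h4 | h4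
    · obtain ⟨F, -, hF, h⟩ := SimpleGraph.exists_isSparse_quarter htri Finset.univ
      rw [hcard, he] at h
      have hR : 8 * (n : ℝ) - 1 * (2 * m) ≤ 8 * F.card := by exact_mod_cast h
      have ha : (F.card : ℝ) ≤ G.acyclicSetNumber := by
        exact_mod_cast hF.card_le_acyclicSetNumber
      have h8 : n * (8 - d) ≤ 8 * (G.acyclicSetNumber : ℝ) := by nlinarith
      -- Chord over `[2, 4]`: `(8 - d)(d + 2) - 24 = (d - 2)(4 - d)`.
      nlinarith [mul_le_mul_of_nonneg_right h8 hpos.le,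
        mul_nonneg hnpos.le (mul_nonneg (sub_nonneg.2 hd2) (sub_nonneg.2 h4))]
    · set D := ⌈d⌉₊ with hDdef
      have hdD : d ≤ D := Nat.le_ceil d
      have hDd : (D : ℝ) < d + 1 := Nat.ceil_lt_add_one (by linarith)
      have hD4 : 4 ≤ D := by
        have : (4 : ℝ) ≤ D := by linarith
        exact_mod_cast this
      obtain ⟨F, -, hF, h⟩ := SimpleGraph.exists_isSparse_chord htri D hD4 Finset.univ
      rw [hcard, he] at h
      have hR : 3 * (2 * (D : ℝ) + 1) * n - 3 * (2 * m) ≤ (D + 1) * (D + 2) * F.card := by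
        exact_mod_cast h
      have ha : (F.card : ℝ) ≤ G.acyclicSetNumber := by
        exact_mod_cast hF.card_le_acyclicSetNumber
      have hDpos : (0 : ℝ) < (D + 1) * (D + 2) := by positivity
      have h8 : 3 * n * (2 * D + 1 - d) ≤ (D + 1) * (D + 2) * (G.acyclicSetNumber : ℝ) := by
        nlinarith [mul_le_mul_of_nonneg_left ha hDpos.le]
      refine le_of_mul_le_mul_left ?_ hDpos
      have h9 := mul_le_mul_of_nonneg_right h8 hpos.le
      -- This product is the gap between chord and curve after clearing denominators.
      have h10 : 0 ≤ 3 * n * ((d - (D - 1)) * (D - d)) := by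
        have h11 : 0 ≤ d - (D - 1) := by linarith
        have h12 : 0 ≤ D - d := by linarith
        positivity
      linarith
  · rw [gt_iff_lt, lt_div_iff₀ hpos, hm']
    have : 0 < n * ((d - 2) * (d - 4)) :=
      mul_pos hnpos (mul_pos (by linarith) (by linarith))
    linarith
  · rw [gt_iff_lt, lt_div_iff₀ hpos, hm']
    -- The larger root is about `4.483`, just below `9 / 2`; the term `-5` in the compared bound
    -- makes the inequality strict.
    have h1 : 0 ≤ 5 * d ^ 2 - 30 * d + 34 := by nlinarith
    nlinarith [mul_nonneg hnpos.le h1]
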